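/- Theorem. A randomized one-pass streaming algorithm over a universe $U$ of items keeps a bit string as its memory; it reads the items $x_1,x_2,\dots\in U$ of a stream one after the other, updates its memory after each of them, and after $n$ items reports a real estimate $\tilde F_0^{(n)}$. The update and output rules are arbitrary (measurable) functions of the random coins, the number of items read so far, the memory content and, for the update, the item being read; neither the coins nor the item counter are charged as memory. Let $F_0^{(n)}=|\{x_1,\dots,x_n\}|$ be the number of distinct elements among the first $n$ items. The algorithm is asymptotically exact for $F_0$ with failure probability $\delta$ if for every infinite stream over $U$, $$\Pr\left[\frac{\tilde F_0^{(n)}}{F_0^{(n)}}\xrightarrow{n\to\infty}1\right]\ge 1-\delta .$$ (No bound on the memory is part of this requirement.) Let $s(n)\in\mathbb{N}\cup\{\infty\}$ be the least $s$ such that on every stream over $U$ and after every number $t\le n$ of items, the memory content has, with probability one, at most $s$ bits. Any asymptotically exact streaming algorithm for estimating $F_0$ requires $\Omega(n)$ memory: for every $0<\delta<1/2$ there are constants $c>0$ and $n_0$, depending only on $\delta$, such that for every universe $U$ (for example $U=[N]=\{1,\dots,N\}$, or $U=\mathbb{N}$), every streaming algorithm over $U$ that is asymptotically exact for $F_0$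 with failure probability $\delta$, and every $n\ge n_0$ with $n\le |U|$, $$s(n)\ge c\,n .$$ -/

import Mathlib

open MeasureTheory Filter Topology
open scoped ENNReal

/-- A randomized one-pass streaming algorithm over a universe `U` of items that outputs real
estimates. The memory content is a bit string. The algorithm reads the items one after the other
and sees the past of the stream only through its memory. `Ω` carries the outcomes of all the
random coins; coins and a clock (the number of items read so far) may be consulted free of charge,
and the update and output rules are arbitrary functions, so that every concrete machine
model is covered. The last three fields say that all random choices are random variables. -/
structure StreamingAlgorithm (Ω : Type*) [MeasurableSpace Ω] (U : Type*) where
  /-- the initial memory content -/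
  init : Ω → List Bool
  /-- the new memory content, from the coins, the number of items read before,
  the old memory content and the item being read -/
  step : Ω → ℕ → List Bool → U → List Bool
  /-- the estimate reported, from the coins, the number of items read and the memory content -/
  output : Ω → ℕ → List Bool → ℝ
  measurableSet_init : ∀ m : List Bool, MeasurableSet {ω | init ω = m}
  measurableSet_step : ∀ (t : ℕ) (m : List Bool) (u : U) (m' : List Bool),
    MeasurableSet {ω | step ω t m u = m'}
  measurable_output : ∀ (t : ℕ) (m : List Bool), Measurable fun ω => output ω t m

/-- `F₀` of the first `n` items of a stream: the number of distinct items among them. -/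
noncomputable def distinctCount {U : Type*} (x : ℕ → U) (n : ℕ) : ℕ :=
  (x '' Set.Iio n).ncard

namespace StreamingAlgorithm

variable {Ω : Type*} [MeasurableSpace Ω] {U : Type*}

/-- The memory content after the first `t` items `x 0, …, x (t - 1)` of the stream `x`. -/
def memory (A : StreamingAlgorithm Ω U) (ω : Ω) (x : ℕ → U) : ℕ → List Bool
  | 0 => A.init ω
  | t + 1 => A.step ω t (A.memory ω x t) (x t)

/-- The estimate reported after the first `n` items of the stream `x`. -/
def estimate (A : StreamingAlgorithm Ω U) (ω : Ω) (x : ℕ → U) (n : ℕ) : ℝ :=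
  A.output ω n (A.memory ω x n)

/-- The guarantee of an asymptotically exact algorithm for `F₀` with failure probability `δ`:
for every infinite stream, with probability at least `1 - δ` the ratio of the reported estimate
to the true value of `F₀` of the prefix read so far tends to one. -/
def IsAsymptoticallyExact (A : StreamingAlgorithm Ω U) (P : Measure Ω) (δ : ℝ) : Prop :=
  ∀ x : ℕ → U, 1 - δ ≤
    P.real {ω | Tendsto (fun n : ℕ => A.estimate ω x n / (distinctCount x n : ℝ)) atTop (𝓝 1)}

/-- The space used on at most `n` items, in bits: the least `s` such that on every stream, at
every time `t ≤ n`, the memory content has almost surely at most `s` bits (`⊤` if there is none).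
It is at most the maximum over all streams and all coin outcomes. -/
noncomputable def space (A : StreamingAlgorithm Ω U) (P : Measure Ω) (n : ℕ) : ℕ∞ :=
  sInf {s : ℕ∞ | ∀ (x : ℕ → U) (t : ℕ), t ≤ n →
    ∀ᵐ ω ∂P, ((A.memory ω x t).length : ℕ∞) ≤ s}

end StreamingAlgorithm

/-! Reduction from the index problem. A word `b` of `k = n / 2` bits is streamed as the items `e (i,
b i)`, then `e (j, true)` is repeated forever. `F₀` settles at `k` or `k + 1` according to `b j`, so
a successful estimate has a limit that reveals `b j` (`eq_of_mem_success`). The memory after `k`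
items is independent of `j`, hence encodes all of `b` with error at most `δ` per bit. Averaging
fixes coins with mean distortion at most `δ * k`, and a rate-distortion bound
(`linear_bits_of_distortion`) forces about `(1 - H(δ)) * k` bits, with `H(δ) < 1` since `δ < 1 / 2`.
-/

/-! ### Rate-distortion bound for lossy codes. -/

/-- The generating function of the Hamming distance to a fixed word. -/
theorem sum_exp_neg_mul_hammingDist (k : ℕ) (c : Fin k → Bool) (l : ℝ) :
    ∑ b : Fin k → Bool, Real.exp (-l * hammingDist b c) = (1 + Real.exp (-l)) ^ k := by
  have h (b : Fin k → Bool) : Real.exp (-l * hammingDist b c)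
      = ∏ i, if b i = c i then 1 else Real.exp (-l) := by
    rw [Finset.prod_ite, Finset.prod_const_one, one_mul, Finset.prod_const, ← Real.exp_nat_mul,
      mul_comm]
    rfl
  simp_rw [h]
  have h2 := Finset.prod_univ_sum (fun _ : Fin k => (Finset.univ : Finset Bool))
    (fun i a => if a = c i then (1 : ℝ) else Real.exp (-l))
  rw [Fintype.piFinset_univ] at h2
  rw [← h2]
  have h3 (i : Fin k) : ∑ a : Bool, (if a = c i then (1 : ℝ) else Real.exp (-l))
      = 1 + Real.exp (-l) := by
    cases hc : c i <;> simp [add_comm]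
  rw [Finset.prod_congr rfl fun i _ => h3 i, Finset.prod_const, Finset.card_fin]

/-- A lossy code for words of `k` bits whose average distortion is at most `δ * k` needs many
codewords. -/
theorem two_pow_mul_exp_le_card_mul {M : Type*} (k : ℕ) (S : Finset M)
    (enc : (Fin k → Bool) → M) (dec : M → Fin k → Bool) (henc : ∀ b, enc b ∈ S) (δ l : ℝ)
    (hl : 0 ≤ l)
    (hd : ∑ b : Fin k → Bool, (hammingDist b (dec (enc b)) : ℝ) ≤ 2 ^ k * (k * δ)) :
    2 ^ k * Real.exp (-l * (k * δ)) ≤ S.card * (1 + Real.exp (-l)) ^ k := by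
  have hcard : ((Fintype.card (Fin k → Bool) : ℕ) : ℝ) = 2 ^ k := by simp
  calc 2 ^ k * Real.exp (-l * (k * δ))
      -- Jensen's inequality by hand: the tangent of `exp (-l * d)` at `d = k * δ`, averaged over
      -- `b`.
      ≤ ∑ b : Fin k → Bool, Real.exp (-l * (k * δ)) *
          (1 + l * (k * δ) - l * hammingDist b (dec (enc b))) := by
        rw [← Finset.mul_sum, Finset.sum_sub_distrib, ← Finset.mul_sum, Finset.sum_const,
          Finset.card_univ, nsmul_eq_mul, hcard, mul_comm]
        refine mul_le_mul_of_nonneg_left ?_ (Real.exp_nonneg _)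
        nlinarith [mul_le_mul_of_nonneg_left hd hl]
    _ ≤ ∑ b : Fin k → Bool, Real.exp (-l * hammingDist b (dec (enc b))) := by
        refine Finset.sum_le_sum fun b _ => ?_
        have h := Real.add_one_le_exp (l * (k * δ) - l * hammingDist b (dec (enc b)))
        have h2 : Real.exp (-l * hammingDist b (dec (enc b))) = Real.exp (-l * (k * δ)) *
            Real.exp (l * (k * δ) - l * hammingDist b (dec (enc b))) := by
          rw [← Real.exp_add]; ring_nf
        rw [h2]
        refine mul_le_mul_of_nonneg_left ?_ (Real.exp_nonneg _)
        linarith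
    -- Summing over all codewords removes the dependence on the encoder.
    _ ≤ ∑ b : Fin k → Bool, ∑ m ∈ S, Real.exp (-l * hammingDist b (dec m)) :=
        Finset.sum_le_sum fun b _ =>
          Finset.single_le_sum (f := fun m => Real.exp (-l * hammingDist b (dec m)))
            (fun _ _ => Real.exp_nonneg _) (henc b)
    _ = S.card * (1 + Real.exp (-l)) ^ k := by
        rw [Finset.sum_comm]
        simp_rw [sum_exp_neg_mul_hammingDist, Finset.sum_const, nsmul_eq_mul]

/-- There are at most `2 ^ (s + 1)` bit strings of length at most `s`. -/
theorem exists_finset_bitStrings (s : ℕ) :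
    ∃ S : Finset (List Bool), (∀ m : List Bool, m.length ≤ s → m ∈ S) ∧
      S.card ≤ 2 ^ (s + 1) := by
  classical
  refine ⟨(Finset.range (s + 1)).biUnion fun l =>
    (Finset.univ : Finset (Fin l → Bool)).image List.ofFn, fun m hm => ?_, ?_⟩
  · simp only [Finset.mem_biUnion, Finset.mem_range, Finset.mem_image, Finset.mem_univ, true_and]
    exact ⟨m.length, by omega, m.get, List.ofFn_get m⟩
  · refine Finset.card_biUnion_le.trans ?_
    calc ∑ l ∈ Finset.range (s + 1), ((Finset.univ : Finset (Fin l → Bool)).image List.ofFn).card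
        ≤ ∑ l ∈ Finset.range (s + 1), 2 ^ l :=
          Finset.sum_le_sum fun l _ => Finset.card_image_le.trans (by simp)
      _ ≤ 2 ^ (s + 1) := by
          rw [Nat.geomSum_eq le_rfl]; simp

/-- Bounded distortion below `1 / 2` costs a linear number of bits. -/
theorem linear_bits_of_distortion (k s : ℕ) (enc : (Fin k → Bool) → List Bool)
    (dec : List Bool → Fin k → Bool) (henc : ∀ b, (enc b).length ≤ s) (δ : ℝ) (hδ₀ : 0 < δ)
    (hδ : δ < 1 / 2)
    (hd : ∑ b : Fin k → Bool, (hammingDist b (dec (enc b)) : ℝ) ≤ 2 ^ k * (k * δ)) :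
    k * (Real.log 2 - Real.binEntropy δ) ≤ (s + 1) * Real.log 2 := by
  obtain ⟨S, hS, hcard⟩ := exists_finset_bitStrings s
  -- The optimal tilt, with `exp (-l) = δ / (1 - δ)`: it makes the binary entropy appear.
  set l := Real.log (1 - δ) - Real.log δ with hldef
  have hl : 0 ≤ l := sub_nonneg.2 (Real.log_le_log hδ₀ (by linarith))
  have hexp : 1 + Real.exp (-l) = (1 - δ)⁻¹ := by
    rw [hldef, neg_sub, Real.exp_sub, Real.exp_log hδ₀, Real.exp_log (by linarith)]
    have : 1 - δ ≠ 0 := by linarith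
    field_simp
    ring
  have h := two_pow_mul_exp_le_card_mul k S enc dec (fun b => hS _ (henc b)) δ l hl hd
  have hc : (S.card : ℝ) ≤ 2 ^ (s + 1) := by exact_mod_cast hcard
  have hpos : 0 < (1 - δ)⁻¹ := inv_pos.2 (by linarith)
  rw [hexp] at h
  have h2 : 2 ^ k * Real.exp (-l * (k * δ)) ≤ 2 ^ (s + 1) * ((1 - δ)⁻¹) ^ k :=
    h.trans (mul_le_mul_of_nonneg_right hc (by positivity))
  have h3 := Real.log_le_log (by positivity) h2
  rw [Real.log_mul (by positivity) (by positivity), Real.log_mul (by positivity) (by positivity),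
    Real.log_exp, Real.log_pow, Real.log_pow, Real.log_pow, Real.log_inv] at h3
  rw [Real.binEntropy_eq_negMulLog_add_negMulLog_one_sub]
  simp only [Real.negMulLog]
  push_cast at h3
  rw [hldef] at h3
  linarith

/-! ### Index streams and their distinct counts. -/

/-- The stream of the index problem: the items that encode the word `b`, then the query item
`(j, true)` forever. -/
def indexStream {U : Type*} {k : ℕ} (e : Fin k × Bool → U) (b : Fin k → Bool) (j : Fin k)
    (t : ℕ) : U :=
  if h : t < k then e (⟨t, h⟩, b ⟨t, h⟩) else e (j, true)

theorem indexStream_eq_of_lt {U : Type*} {k : ℕ} (e : Fin k × Bool → U) (b : Fin k → Bool)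
    (j j' : Fin k) {t : ℕ} (h : t < k) : indexStream e b j t = indexStream e b j' t := by
  simp [indexStream, h]

theorem indexStream_eq_of_le {U : Type*} {k : ℕ} (e : Fin k × Bool → U) (b b' : Fin k → Bool)
    (j : Fin k) {t : ℕ} (h : k ≤ t) : indexStream e b j t = indexStream e b' j t := by
  simp [indexStream, h.not_gt]

theorem distinctCount_indexStream {U : Type*} {k : ℕ} {e : Fin k × Bool → U}
    (he : Function.Injective e) (b : Fin k → Bool) (j : Fin k) {n : ℕ} (hn : k < n) :
    distinctCount (indexStream e b j) n = if b j = true then k else k + 1 := by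
  have himg : indexStream e b j '' Set.Iio n
      = insert (e (j, true)) (Set.range fun i => e (i, b i)) := by
    ext u
    simp only [Set.mem_image, Set.mem_Iio, Set.mem_insert_iff, Set.mem_range]
    constructor
    · rintro ⟨t, -, rfl⟩
      by_cases h : t < k
      · exact Or.inr ⟨⟨t, h⟩, by simp [indexStream, h]⟩
      · exact Or.inl (by simp [indexStream, h])
    · rintro (rfl | ⟨i, rfl⟩)
      · exact ⟨k, hn, by simp [indexStream]⟩
      · exact ⟨i, i.2.trans hn, by simp [indexStream]⟩
  have hinj : Function.Injective fun i => e (i, b i) := fun i i' h => (Prod.ext_iff.1 (he h)).1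
  have hcard : (Set.range fun i => e (i, b i)).ncard = k := by
    rw [← Set.image_univ, Set.ncard_image_of_injective _ hinj]
    simp
  rw [distinctCount, himg]
  split_ifs with hb
  · have hmem : e (j, true) ∈ Set.range fun i => e (i, b i) := ⟨j, by simp [hb]⟩
    rw [Set.insert_eq_of_mem hmem, hcard]
  · rw [Set.ncard_insert_of_notMem _ (Set.finite_range _), hcard]
    rintro ⟨i, hi⟩
    obtain ⟨h1, h2⟩ := Prod.ext_iff.1 (he hi)
    simp only at h1 h2
    exact hb (h1 ▸ h2)

/-! ### From a streaming algorithm to a lossy code. -/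

namespace StreamingAlgorithm

/-- The event that the ratio of the estimate to the true number of distinct items tends to one. -/
def success {Ω : Type*} [MeasurableSpace Ω] {U : Type*} (A : StreamingAlgorithm Ω U)
    (x : ℕ → U) : Set Ω :=
  {ω | Tendsto (fun n : ℕ => A.estimate ω x n / (distinctCount x n : ℝ)) atTop (𝓝 1)}

variable {Ω : Type*} [MeasurableSpace Ω] {U : Type*} (A : StreamingAlgorithm Ω U)

/-- Measurability of `step` is given for each fixed memory content; there are only countably many
bit strings to split over. -/
theorem measurableSet_memory_eq (x : ℕ → U) (t : ℕ) (m : List Bool) :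
    MeasurableSet {ω | A.memory ω x t = m} := by
  induction t generalizing m with
  | zero => exact A.measurableSet_init m
  | succ t ih =>
    have : {ω | A.memory ω x (t + 1) = m}
        = ⋃ m', {ω | A.memory ω x t = m'} ∩ {ω | A.step ω t m' (x t) = m} := by
      ext ω
      simp [memory]
    rw [this]
    exact MeasurableSet.iUnion fun m' => (ih m').inter (A.measurableSet_step t m' (x t) m)

theorem measurable_estimate (x : ℕ → U) (n : ℕ) : Measurable fun ω => A.estimate ω x n := by
  intro B hB
  have : (fun ω => A.estimate ω x n) ⁻¹' B
      = ⋃ m, {ω | A.memory ω x n = m} ∩ (fun ω => A.output ω n m) ⁻¹' B := by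
    ext ω
    simp [estimate]
  rw [this]
  exact MeasurableSet.iUnion fun m =>
    (A.measurableSet_memory_eq x n m).inter (A.measurable_output n m hB)

theorem measurableSet_success (x : ℕ → U) : MeasurableSet (A.success x) :=
  measurableSet_tendsto _ fun n => (A.measurable_estimate x n).div_const _

theorem memory_congr (ω : Ω) {x y : ℕ → U} {t : ℕ} (h : ∀ i < t, x i = y i) :
    A.memory ω x t = A.memory ω y t := by
  induction t with
  | zero => rfl
  | succ t ih =>
    rw [memory, memory, ih fun i hi => h i (hi.trans t.lt_succ_self), h t t.lt_succ_self]

theorem memory_eq_of_memory_eq (ω : Ω) {x y : ℕ → U} {k : ℕ}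
    (hk : A.memory ω x k = A.memory ω y k) (h : ∀ i, k ≤ i → x i = y i) {t : ℕ} (ht : k ≤ t) :
    A.memory ω x t = A.memory ω y t := by
  induction t, ht using Nat.le_induction with
  | base => exact hk
  | succ t ht ih => rw [memory, memory, ih, h t ht]

theorem tendsto_estimate_of_mem_success {ω : Ω} {x : ℕ → U} (hω : ω ∈ A.success x) {c : ℕ}
    (hc : c ≠ 0) (hx : ∀ᶠ n in atTop, distinctCount x n = c) :
    Tendsto (fun n => A.estimate ω x n) atTop (𝓝 (c : ℝ)) := by
  have h : Tendsto (fun n : ℕ => A.estimate ω x n / (distinctCount x n : ℝ) * c) atTop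
      (𝓝 (1 * (c : ℝ))) := Tendsto.mul_const _ hω
  rw [one_mul] at h
  refine h.congr' ?_
  filter_upwards [hx] with n hn
  rw [hn, div_mul_cancel₀ _ (Nat.cast_ne_zero.2 hc)]

/-- If the algorithm succeeds on two streams that continue with the same query from the same
memory content, then the encoded words agree at the queried position. -/
theorem eq_of_mem_success {k : ℕ} {e : Fin k × Bool → U} (he : Function.Injective e) {ω : Ω}
    {b b' : Fin k → Bool} {j : Fin k} (hb : ω ∈ A.success (indexStream e b j))
    (hb' : ω ∈ A.success (indexStream e b' j))
    (hm : A.memory ω (indexStream e b j) k = A.memory ω (indexStream e b' j) k) :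
    b j = b' j := by
  have hk : k ≠ 0 := j.pos.ne'
  have key (a : Fin k → Bool) (ha : ω ∈ A.success (indexStream e a j)) :=
    A.tendsto_estimate_of_mem_success ha (c := if a j = true then k else k + 1)
      (by split_ifs <;> omega)
      ((eventually_gt_atTop k).mono fun n hn => distinctCount_indexStream he a j hn)
  have h2 := (key b hb).congr' (f₂ := fun n => A.estimate ω (indexStream e b' j) n) (by
    filter_upwards [eventually_ge_atTop k] with n hn
    rw [estimate, estimate,
      A.memory_eq_of_memory_eq ω hm (fun i hi => indexStream_eq_of_le e b b' j hi) hn])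
  have h3 : (if b j = true then k else k + 1) = if b' j = true then k else k + 1 := by
    exact_mod_cast tendsto_nhds_unique h2 (key b' hb')
  cases h4 : b j <;> cases h5 : b' j <;> simp [h4, h5] at h3 ⊢

open Classical in
/-- For every coin outcome, the memory contents after `k` items encode words of `k` bits with
errors only where the algorithm fails on the corresponding index stream. -/
theorem exists_decoder {k : ℕ} {e : Fin k × Bool → U} (he : Function.Injective e) (ω : Ω)
    (enc : (Fin k → Bool) → List Bool)
    (henc : ∀ b j, A.memory ω (indexStream e b j) k = enc b) :
    ∃ dec : List Bool → Fin k → Bool, ∀ b,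
      (hammingDist b (dec (enc b)) : ℝ)
        ≤ ∑ j, (A.success (indexStream e b j))ᶜ.indicator (fun _ => (1 : ℝ)) ω := by
  -- Bit `j` is set if some word with this memory content has it set and succeeds; a success on `b`
  -- itself excludes a false witness.
  refine ⟨fun m j => decide (∃ b, enc b = m ∧ b j = true ∧ ω ∈ A.success (indexStream e b j)),
    fun b => ?_⟩
  simp only [Set.indicator_apply, Finset.sum_boole]
  refine Nat.cast_le.2 (Finset.card_le_card fun j => ?_)
  simp only [Finset.mem_filter, Finset.mem_univ, true_and, Set.mem_compl_iff]
  intro hne hs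
  apply hne
  cases hbj : b j
  · symm
    rw [decide_eq_false_iff_not]
    rintro ⟨b', hm, hb', hs'⟩
    have := A.eq_of_mem_success he hs hs' (by rw [henc, henc, hm])
    rw [hbj, hb'] at this
    exact absurd this (by decide)
  · symm
    rw [decide_eq_true_iff]
    exact ⟨b, rfl, hbj, hs⟩

/-- `ℕ∞` is well-ordered, so the infimum is attained. -/
theorem ae_length_memory_le_space (P : Measure Ω) (n : ℕ) (x : ℕ → U) {t : ℕ} (ht : t ≤ n) :
    ∀ᵐ ω ∂P, ((A.memory ω x t).length : ℕ∞) ≤ A.space P n :=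
  (csInf_mem (s := {s : ℕ∞ | ∀ (x : ℕ → U) (t : ℕ), t ≤ n →
    ∀ᵐ ω ∂P, ((A.memory ω x t).length : ℕ∞) ≤ s})
    ⟨⊤, fun _ _ _ => ae_of_all _ fun _ => le_top⟩) x t ht

/-- The space lower bound in terms of the number `k` of encoded bits. -/
theorem mul_le_of_space_eq (P : Measure Ω) [IsProbabilityMeasure P] {δ : ℝ} (hδ₀ : 0 < δ)
    (hδ : δ < 1 / 2) (hA : A.IsAsymptoticallyExact P δ) {k n s : ℕ} (hk : 0 < k) (hkn : k ≤ n)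
    {e : Fin k × Bool → U} (he : Function.Injective e) (hs : A.space P n = s) :
    k * (Real.log 2 - Real.binEntropy δ) ≤ (s + 1) * Real.log 2 := by
  -- An arbitrary query: the first `k` items do not depend on it.
  let j₀ : Fin k := ⟨0, hk⟩
  have hae : ∀ᵐ ω ∂P, ∀ b : Fin k → Bool,
      (A.memory ω (indexStream e b j₀) k).length ≤ s := by
    rw [ae_all_iff]
    intro b
    filter_upwards [A.ae_length_memory_le_space P n (indexStream e b j₀) hkn] with ω hω
    rw [hs] at hω
    exact_mod_cast hω
  let F : (Fin k → Bool) → Fin k → Ω → ℝ := fun b j =>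
    (A.success (indexStream e b j))ᶜ.indicator fun _ => 1
  have hmeas (b : Fin k → Bool) (j : Fin k) : MeasurableSet (A.success (indexStream e b j))ᶜ :=
    (A.measurableSet_success _).compl
  have hint (b : Fin k → Bool) (j : Fin k) : Integrable (F b j) P :=
    (integrable_const 1).indicator (hmeas b j)
  have hF (b : Fin k → Bool) (j : Fin k) : ∫ ω, F b j ω ∂P ≤ δ := by
    have h1 : ∫ ω, F b j ω ∂P = P.real (A.success (indexStream e b j))ᶜ :=
      integral_indicator_one (hmeas b j)
    have h2 : 1 - δ ≤ P.real (A.success (indexStream e b j)) := hA _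
    rw [h1, probReal_compl_eq_one_sub (A.measurableSet_success _)]
    linarith
  have hsum : ∫ ω, ∑ b, ∑ j, F b j ω ∂P ≤ 2 ^ k * (k * δ) := by
    rw [integral_finsetSum _ fun b _ => integrable_finsetSum _ fun j _ => hint b j]
    calc ∑ b, ∫ ω, ∑ j, F b j ω ∂P = ∑ b, ∑ j, ∫ ω, F b j ω ∂P :=
          Finset.sum_congr rfl fun b _ => integral_finsetSum _ fun j _ => hint b j
      _ ≤ ∑ _b : Fin k → Bool, ∑ _j : Fin k, δ :=
          Finset.sum_le_sum fun b _ => Finset.sum_le_sum fun j _ => hF b j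
      _ = 2 ^ k * (k * δ) := by simp
  -- One coin outcome off the null set, with total distortion at most its mean.
  obtain ⟨ω, hω, hle⟩ := exists_notMem_null_le_integral
    (integrable_finsetSum _ fun b _ => integrable_finsetSum _ fun j _ => hint b j) hae
  have hlen := not_not.1 hω
  obtain ⟨dec, hdec⟩ := A.exists_decoder he ω (fun b => A.memory ω (indexStream e b j₀) k)
    fun b j => A.memory_congr ω fun i hi => indexStream_eq_of_lt e b j j₀ hi
  exact linear_bits_of_distortion k s _ dec hlen δ hδ₀ hδ
    ((Finset.sum_le_sum fun b _ => hdec b).trans (hle.trans hsum))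

end StreamingAlgorithm

/-! ### Choice of constants. -/

theorem exists_injective_of_le_card {U : Type*} {k n : ℕ} (hn : (n : ℕ∞) ≤ ENat.card U)
    (hk : 2 * k ≤ n) : ∃ e : Fin k × Bool → U, Function.Injective e := by
  rcases finite_or_infinite U with hU | hU
  · have := Fintype.ofFinite U
    rw [ENat.card_eq_coe_fintype_card, Nat.cast_le] at hn
    obtain ⟨f⟩ := Function.Embedding.nonempty_of_card_le (α := Fin k × Bool) (β := U)
      (by simp; omega)
    exact ⟨f, f.injective⟩
  · obtain ⟨f⟩ := nonempty_embedding_nat (Fin k × Bool)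
    exact ⟨f.trans (Infinite.natEmbedding U), (f.trans (Infinite.natEmbedding U)).injective⟩

theorem mainTheorem2 (δ : ℝ) (hδ₀ : 0 < δ) (hδ : δ < 1 / 2) :
    ∃ c : ℝ, 0 < c ∧ ∃ n₀ : ℕ,
      ∀ (U : Type*) (Ω : Type*) [MeasurableSpace Ω] (P : Measure Ω) [IsProbabilityMeasure P]
        (A : StreamingAlgorithm Ω U), A.IsAsymptoticallyExact P δ →
        ∀ n : ℕ, n₀ ≤ n → (n : ℕ∞) ≤ ENat.card U →
          ENNReal.ofReal (c * n) ≤ (A.space P n : ℝ≥0∞) := by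
  have hlog : 0 < Real.log 2 := Real.log_pos one_lt_two
  have hg : 0 < Real.log 2 - Real.binEntropy δ :=
    sub_pos.2 (Real.binEntropy_lt_log_two.2 (by norm_num; linarith))
  set g := (Real.log 2 - Real.binEntropy δ) / Real.log 2 with hgdef
  have hgpos : 0 < g := div_pos hg hlog
  -- From `k ≥ (n - 1) / 2`, `s ≥ g * (n - 1) / 2 - 1`, which is at least `g * n / 4` once `g * n ≥
  -- 4 + 2 * g`; the `+ 2` ensures `k > 0`.
  refine ⟨g / 4, by positivity, ⌈(4 + 2 * g) / g⌉₊ + 2, fun U Ω _ P _ A hA n hn hU => ?_⟩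
  by_cases htop : A.space P n = ⊤
  · simp [htop]
  obtain ⟨s, hs⟩ := ENat.ne_top_iff_exists.1 htop
  obtain ⟨e, he⟩ := exists_injective_of_le_card (k := n / 2) hU (by omega)
  have h := A.mul_le_of_space_eq P hδ₀ hδ hA (k := n / 2) (by omega) (by omega) he hs.symm
  have h1 : (n / 2 : ℕ) * g ≤ s + 1 := by
    rw [hgdef, ← mul_div_assoc, div_le_iff₀ hlog]
    exact h
  have h2 : (n : ℝ) ≤ 2 * (n / 2 : ℕ) + 1 := by
    exact_mod_cast (by omega : n ≤ 2 * (n / 2) + 1)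
  have h3 : 4 + 2 * g ≤ n * g := by
    rw [← div_le_iff₀ hgpos]
    exact (Nat.le_ceil _).trans (by exact_mod_cast (by omega))
  have h4 : g / 4 * n ≤ s := by nlinarith [mul_le_mul_of_nonneg_right h2 hgpos.le]
  rw [← hs, ENat.toENNReal_coe, ← ENNReal.ofReal_natCast]
  exact ENNReal.ofReal_le_ofReal h4
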